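/- Let $A\in\mathbb N_+$ and let $T=(V,E)$ be the infinite rooted tree in which every node has exactly $A$ children, with $V=\{(j,k): j\in\mathbb N,\ 1\le k\le A^j\}$ ($\mathbb N$ includes $0$; the root is $(0,1)$), where the children of $(j,k)$ are $(j+1,A(k-1)+1),\dots,(j+1,Ak)$. Let $d_T$ be the (undirected) graph metric of $T$, and $d_T(I,J)=\inf\{d_T(v,w):v\in I,w\in J\}$ for $I,J\subseteq V$ (with $\inf\emptyset=\infty$). Let $0<\sigma,C<\infty$ and let $Z=\{Z_v\}_{v\in V}$ be real random variables on a probability space $(\Omega,\mathcal A,\mathbb P)$ with $\mathbb E[Z_v]=0$, $\|Z_v\|_\infty\le C$ and $\operatorname{Var}(Z_v)\le\sigma^2$ for all $v\in V$. For $n\in\mathbb N$ put $$\alpha_T(n)=\sup_{\substack{I,J\subseteq V\\ d_T(I,J)\ge n}}\ \sup_{F\in\mathcal F(I),\,G\in\mathcal F(J)}|\mathbb P(F\cap G)-\mathbb P(F)\mathbb P(G)|,\qquad \mathcal F(I)=\sigma(Z_v:v\in I).$$ For $P\in\mathbb N_+$ and $(j,k)\in V$ let $V(j,k,P)=\{(j',k')\in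 V: j\le j'\le j+P-1,\ A^{j'-j}(k-1)+1\le k'\le A^{j'-j}k\}$, and for $1\le l\le 2(P-1)$ let $$N(P,l)=\sum_{h=0}^{\lfloor P-1-l/2\rfloor}A^h\sum_{i=\max\{1,\,l-(P-1-h)\}}^{\min\{l,\,P-1-h\}}A^i\left(2\cdot 1_{\{l=i\}}+(A-1)A^{l-i-1}1_{\{l>i\}}\right).$$ Let $L\in\mathbb N$, $P\in\mathbb N_+$ and $V'=V(L,1,P)\cup\dots\cup V(L,A^L,P)$. Let $P_2,Q_2\in\mathbb N_+$ satisfy $Q_2\le P_2$ and $P_2+Q_2<A^L$, let $f=2\lceil \log Q_2/\log A\rceil$, and let $\beta\in\mathbb R$ satisfy $\beta\le\frac{A-1}{4eCP_2(A^P-1)}$. Then for every $\epsilon>0$ $$\begin{aligned}\mathbb P\Big(\Big|\sum_{v\in V'}Z_v\Big|>\epsilon\Big)\le{}& 2e^{-\beta\epsilon}\exp\Big\{10\sqrt e\,\alpha_T(f)^{(P_2+Q_2)/(2P_2+2Q_2+A^L)}\frac{A^L}{P_2+Q_2}\Big\}\\ &\cdot\exp\Big\{4\beta^2e\,P_2^2\Big(\frac{A^P-1}{A-1}\sigma^2+4C^2\sum_{k=1}^{2(P-1)}\alpha_T(k)N(P,k)\Big)\Big(\frac{A^L}{P_2+Q_2}+1\Big)\Big\}.\end{aligned}$$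 -/

import Mathlib

open MeasureTheory ProbabilityTheory

namespace ExpTree

/-- Nodes of the rooted tree in which every node has exactly `A` children: the nodes of
generation `j` are labelled `(j, 1), …, (j, A ^ j)`. -/
abbrev Node (A : ℕ) : Type := {v : ℕ × ℕ // 1 ≤ v.2 ∧ v.2 ≤ A ^ v.1}

/-- The generation `j` of the node `(j, k)`. -/
def Node.gen {A : ℕ} (v : Node A) : ℕ := v.1.1

/-- The position `k` of the node `(j, k)` in its generation. -/
def Node.pos {A : ℕ} (v : Node A) : ℕ := v.1.2

/-- `w` is one of the `A` children of `v`. -/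
def IsChild {A : ℕ} (v w : Node A) : Prop :=
  w.gen = v.gen + 1 ∧ A * (v.pos - 1) + 1 ≤ w.pos ∧ w.pos ≤ A * v.pos

/-- The tree growing at exponential rate `A`, as an undirected graph. -/
def tree (A : ℕ) : SimpleGraph (Node A) where
  Adj v w := IsChild v w ∨ IsChild w v
  symm := ⟨fun _ _ h => h.symm⟩
  loopless := ⟨fun v h => by
    rcases h with h | h <;> exact absurd h.1 (by omega)⟩

/-- Graph distance between two sets of nodes (infinite if one of them is empty). -/
noncomputable def setDist {V : Type*} (G : SimpleGraph V) (I J : Set V) : ℕ∞ :=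
  ⨅ v ∈ I, ⨅ w ∈ J, G.edist v w

/-- The σ-algebra generated by the variables `Z v`, `v ∈ I`. -/
abbrev sigmaField {V Ω : Type*} (Z : V → Ω → ℝ) (I : Set V) : MeasurableSpace Ω :=
  ⨆ v ∈ I, MeasurableSpace.comap (Z v) inferInstance

/-- The α-mixing coefficients of the random field `Z` with respect to the graph metric of `G`. -/
noncomputable def alphaMixing {V Ω : Type*} [MeasurableSpace Ω] (G : SimpleGraph V)
    (P : Measure Ω) (Z : V → Ω → ℝ) (n : ℕ) : ℝ :=
  sSup {x : ℝ | ∃ I J : Set V, (n : ℕ∞) ≤ setDist G I J ∧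
    ∃ S T : Set Ω, MeasurableSet[sigmaField Z I] S ∧ MeasurableSet[sigmaField Z J] T ∧
      x = |P.real (S ∩ T) - P.real S * P.real T|}

/-- The nodes of the subtree that is rooted at `(j, k)` and consists of `P` generations. -/
def subtree (A j k P : ℕ) : Set (Node A) :=
  {v | j ≤ v.gen ∧ v.gen ≤ j + P - 1 ∧
    A ^ (v.gen - j) * (k - 1) + 1 ≤ v.pos ∧ v.pos ≤ A ^ (v.gen - j) * k}

/-- The strip: the union of the `P`-generation subtrees rooted at the nodes of generation `L`. -/
def strip (A L P : ℕ) : Set (Node A) :=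
  ⋃ k ∈ Finset.Icc 1 (A ^ L), subtree A L k P

theorem subtree_finite (A j k P : ℕ) : (subtree A j k P).Finite := by
  have h : ((Finset.Icc j (j + P - 1)).biUnion fun i =>
      (Finset.Icc 1 (A ^ (i - j) * k)).image fun l => (i, l) : Set (ℕ × ℕ)).Finite :=
    Finset.finite_toSet _
  refine (h.preimage (f := fun v : Node A => v.1) Subtype.val_injective.injOn).subset ?_
  intro v hv
  obtain ⟨h1, h2, h3, h4⟩ := hv
  simp only [Set.mem_preimage, Finset.coe_biUnion, Finset.coe_image, Set.mem_iUnion,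
    Set.mem_image, Finset.mem_coe, Finset.mem_Icc]
  exact ⟨v.gen, ⟨h1, h2⟩, v.pos, ⟨v.2.1, h4⟩, rfl⟩

theorem strip_finite (A L P : ℕ) : (strip A L P).Finite :=
  Set.Finite.biUnion (Finset.finite_toSet _) fun k _ => subtree_finite A L k P

/-- The sum of the random field over the strip. -/
noncomputable def stripSum {A : ℕ} {Ω : Type*} (Z : Node A → Ω → ℝ) (L P : ℕ) (ω : Ω) : ℝ :=
  ∑ v ∈ (strip_finite A L P).toFinset, Z v ω

/-- The number `N(P, L)` of ordered pairs of nodes at distance `L` in a subtree with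
`P` generations, for `1 ≤ L ≤ 2 (P - 1)`. -/
def numPairs (A P L : ℕ) : ℕ :=
  ∑ h ∈ Finset.range (⌊(P : ℚ) - 1 - (L : ℚ) / 2⌋₊ + 1),
    A ^ h * ∑ i ∈ Finset.Icc (max 1 (L - (P - 1 - h))) (min L (P - 1 - h)),
      A ^ i * (2 * (if L = i then 1 else 0) +
        (A - 1) * A ^ (L - i - 1) * (if i < L then 1 else 0))

end ExpTree

/-! The proof combines Bernstein's blocking method with the Chernoff bound. Two nodes are joined
through their last common ancestor, so roots in generation `L` whose positions differ by more than
`Q₂` have their last common ancestor at least `⌈log Q₂ / log A⌉` generations above them, and their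
subtrees are at distance at least `f` (`le_meetDist_of_far`).

Cut the `A ^ L` subtrees into alternating blocks of `P₂` and `Q₂` consecutive ones. The inequality
`2xy ≤ x² + y²` for exponentials reduces the moment generating function of the whole sum at `γ` to
those of the two families of blocks at `2γ` (`integral_exp_stripSum_le`). Within a family the blocks
are `f`-separated, so the covariance inequality makes the expectation of the product of their
exponentials nearly the product of the expectations (`integral_prod_le`). The resulting factor `1 +
α m e ^ m` is turned into an exponential by `one_add_mul_exp_le`.

The bound on `β` keeps `2γ` times a block sum `U` in `[-1, 1]`, where `e ^ x ≤ 1 + x + x²`; as `U`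
is centred, its exponential moment is at most `exp ((2γ)² E[U²])`. Cauchy–Schwarz over the at most
`P₂` subtrees of a block reduces `E[U²]` to second moments of single subtrees
(`integral_sq_sum_le`). There the diagonal terms give the variances, and a pair at distance `l`
contributes at most `4 C² α(l)`; the number of such pairs is bounded by `card_pairs_le_numPairs`. -/

namespace ExpTree

/-! ### Ancestors and distances in the tree -/

/-- The position, counted from `0`, of the ancestor of `v` in generation `i ≤ v.gen`. -/
def Node.anc {A : ℕ} (v : Node A) (i : ℕ) : ℕ := (v.pos - 1) / A ^ (v.gen - i)

theorem Node.anc_zero {A : ℕ} (v : Node A) : v.anc 0 = 0 := by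
  have h1 := v.2.1
  have h2 := v.2.2
  refine Nat.div_eq_of_lt ?_
  simp only [Node.pos, Node.gen, Nat.sub_zero]
  omega

theorem Node.anc_gen {A : ℕ} (v : Node A) : v.anc v.gen = v.pos - 1 := by
  simp [Node.anc]

theorem Node.anc_div {A : ℕ} (v : Node A) {i j : ℕ} (hij : i ≤ j) (hj : j ≤ v.gen) :
    v.anc j / A ^ (j - i) = v.anc i := by
  rw [Node.anc, Node.anc, Nat.div_div_eq_div_mul, ← pow_add]
  congr 2
  omega

theorem Node.ext_anc {A : ℕ} {v w : Node A} (hg : v.gen = w.gen)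
    (h : v.anc v.gen = w.anc v.gen) : v = w := by
  rw [Node.anc_gen, hg, Node.anc_gen] at h
  have h1 := v.2.1
  have h2 := w.2.1
  simp only [Node.pos, Node.gen] at *
  exact Subtype.ext (Prod.ext hg (by omega))

/-- Counted from `0`, the children of position `q` occupy `A * q, …, A * q + (A - 1)`, so division
by `A` recovers the parent. -/
theorem IsChild.anc_eq {A : ℕ} {v w : Node A} (h : IsChild v w) {i : ℕ} (hi : i ≤ v.gen) :
    w.anc i = v.anc i := by
  obtain ⟨hg, h1, h2⟩ := h
  have hv : 1 ≤ v.pos := v.2.1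
  obtain ⟨q, hq⟩ : ∃ q, v.pos = q + 1 := ⟨v.pos - 1, by omega⟩
  rw [hq] at h1 h2
  have hpos : (w.pos - 1) / A = v.pos - 1 := by
    rw [hq]
    refine Nat.div_eq_of_lt_le ?_ ?_
    · simp only [Nat.add_sub_cancel] at h1 ⊢
      rw [mul_comm]; omega
    · rw [mul_comm]
      simp only [Nat.add_sub_cancel] at h1 ⊢
      omega
  rw [Node.anc, Node.anc, ← hpos, Nat.div_div_eq_div_mul, ← pow_succ']
  congr 2
  omega

/-- The generation of the last common ancestor. -/
def meet {A : ℕ} (v w : Node A) : ℕ :=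
  Nat.findGreatest (fun i => v.anc i = w.anc i) (min v.gen w.gen)

/-- The length of the path through the last common ancestor. -/
def meetDist {A : ℕ} (v w : Node A) : ℕ := v.gen + w.gen - 2 * meet v w

section
variable {A : ℕ} {v w z : Node A}

theorem meet_le_left : meet v w ≤ v.gen := (Nat.findGreatest_le _).trans (min_le_left _ _)

theorem meet_le_right : meet v w ≤ w.gen := (Nat.findGreatest_le _).trans (min_le_right _ _)

theorem anc_meet : v.anc (meet v w) = w.anc (meet v w) :=
  Nat.findGreatest_spec (P := fun i => v.anc i = w.anc i) (Nat.zero_le _)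
    (by rw [Node.anc_zero, Node.anc_zero])

theorem le_meet {i : ℕ} (hv : i ≤ v.gen) (hw : i ≤ w.gen) (h : v.anc i = w.anc i) :
    i ≤ meet v w :=
  Nat.le_findGreatest (le_min hv hw) h

theorem anc_eq_of_le_meet {i : ℕ} (hi : i ≤ meet v w) : v.anc i = w.anc i := by
  rw [← v.anc_div hi meet_le_left, ← w.anc_div hi meet_le_right, anc_meet]

theorem meet_self : meet v v = v.gen :=
  le_antisymm meet_le_left (le_meet le_rfl le_rfl rfl)

theorem IsChild.meet_le (h : IsChild v w) : meet v z ≤ meet w z :=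
  le_meet (by have := h.1; have := meet_le_left (v := v) (w := z); omega) meet_le_right
    (by rw [h.anc_eq meet_le_left, anc_meet])

theorem IsChild.meet_le_succ (h : IsChild v w) : meet w z ≤ meet v z + 1 := by
  have hc := meet_le_left (v := w) (w := z)
  have hz := meet_le_right (v := w) (w := z)
  have hg := h.1
  have : meet w z - 1 ≤ meet v z :=
    le_meet (by omega) (by omega)
      (by rw [← h.anc_eq (by omega)]; exact anc_eq_of_le_meet (by omega))
  omega

/-- Passing to a child raises the generation by one and the meeting generation by zero or one, so
the path length to a fixed node changes by exactly one. -/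
theorem meetDist_le_succ_of_adj (h : (tree A).Adj v w) : meetDist v z ≤ meetDist w z + 1 := by
  have a1 := meet_le_left (v := v) (w := z)
  have a2 := meet_le_right (v := v) (w := z)
  have a3 := meet_le_left (v := w) (w := z)
  have a4 := meet_le_right (v := w) (w := z)
  unfold meetDist
  rcases h with h | h
  · have b1 := h.meet_le (z := z)
    have b2 := h.meet_le_succ (z := z)
    have := h.1
    omega
  · have b1 := h.meet_le (z := z)
    have b2 := h.meet_le_succ (z := z)
    have := h.1
    omega

theorem meetDist_le_length (p : (tree A).Walk v w) : meetDist v w ≤ p.length := by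
  induction p with
  | nil => simp [meetDist, meet_self]; omega
  | cons h p ih =>
    rw [SimpleGraph.Walk.length_cons]
    exact (meetDist_le_succ_of_adj h).trans (by omega)

/-- Only this half of the distance formula is needed: the mixing coefficients require lower bounds
on distances, and pairs are counted by `meetDist`. -/
theorem meetDist_le_edist (v w : Node A) : (meetDist v w : ℕ∞) ≤ (tree A).edist v w :=
  le_iInf fun p => by exact_mod_cast meetDist_le_length p

theorem meetDist_pos (h : v ≠ w) : 1 ≤ meetDist v w := by
  by_contra hc
  have a1 := meet_le_left (v := v) (w := w)
  have a2 := meet_le_right (v := v) (w := w)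
  unfold meetDist at hc
  refine h (Node.ext_anc (by omega) ?_)
  exact anc_eq_of_le_meet (by omega)

theorem mem_subtree_iff {j k P : ℕ} (hA : 1 ≤ A) (hk : 1 ≤ k) :
    v ∈ subtree A j k P ↔ j ≤ v.gen ∧ v.gen ≤ j + P - 1 ∧ v.anc j = k - 1 := by
  have hv : 1 ≤ v.pos := v.2.1
  obtain ⟨q, rfl⟩ : ∃ q, k = q + 1 := ⟨k - 1, by omega⟩
  have hpow : 0 < A ^ (v.gen - j) := by positivity
  simp only [subtree, Set.mem_ofPred_eq, Node.anc, Nat.add_sub_cancel]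
  rw [Nat.div_eq_iff hpow, mul_comm (A ^ _) q, mul_comm (A ^ _) (q + 1), Nat.add_mul, one_mul]
  constructor
  · rintro ⟨h1, h2, h3, h4⟩
    exact ⟨h1, h2, by omega, by omega⟩
  · rintro ⟨h1, h2, h3, h4⟩
    exact ⟨h1, h2, by omega, by omega⟩

/-- Subtrees whose roots are more than `Q` positions apart are far from each other. -/
theorem le_meetDist_of_far {L k k' P Q : ℕ} (hA : 2 ≤ A) (hQ : 1 ≤ Q) (hk : 1 ≤ k)
    (hk' : 1 ≤ k') (hkk : k + Q < k') (hv : v ∈ subtree A L k P) (hw : w ∈ subtree A L k' P) :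
    2 * ⌈Real.log Q / Real.log A⌉₊ ≤ meetDist v w := by
  rw [mem_subtree_iff (by omega) hk] at hv
  rw [mem_subtree_iff (by omega) hk'] at hw
  obtain ⟨hv1, -, hv2⟩ := hv
  obtain ⟨hw1, -, hw2⟩ := hw
  have hm : meet v w < L := by
    by_contra hc
    have := anc_eq_of_le_meet (v := v) (w := w) (i := L) (by omega)
    omega
  have he := anc_meet (v := v) (w := w)
  rw [← v.anc_div hm.le hv1, ← w.anc_div hm.le hw1, hv2, hw2] at he
  set t := L - meet v w with ht
  have hpos : 0 < A ^ t := by positivity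
  -- Both roots have the same ancestor `t` generations up, so their positions have equal quotients
  -- by `A ^ t` and differ by less than `A ^ t`, yet by more than `Q`.
  have hlt : Q < A ^ t := by
    have e1 := Nat.div_add_mod (k - 1) (A ^ t)
    have e2 := Nat.div_add_mod (k' - 1) (A ^ t)
    have e3 := Nat.mod_lt (k' - 1) hpos
    rw [he] at e1
    generalize (k - 1) % A ^ t = r at e1
    generalize (k' - 1) % A ^ t = r' at e2 e3
    omega
  have hlog : (⌈Real.log Q / Real.log A⌉₊ : ℕ) ≤ t := by
    refine Nat.ceil_le.2 ?_
    have hA' : 0 < Real.log A := Real.log_pos (by exact_mod_cast hA)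
    rw [div_le_iff₀ hA', ← Real.log_pow]
    exact Real.log_le_log (by exact_mod_cast hQ) (by exact_mod_cast hlt.le)
  unfold meetDist
  omega

end

/-! ### Counting nodes and pairs of nodes -/

theorem card_le_of_image_fst_snd {α β : Type*} [DecidableEq α] [DecidableEq β]
    (F : Finset (α × β)) {a b : ℕ} (h1 : (F.image Prod.fst).card ≤ a)
    (h2 : ∀ v, ((F.filter fun p => p.1 = v).image Prod.snd).card ≤ b) : F.card ≤ a * b := by
  refine (Finset.card_le_mul_card_image (f := Prod.fst) F b fun v _ => ?_).trans
    (by rw [mul_comm]; exact Nat.mul_le_mul_right _ h1)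
  rw [← Finset.card_image_of_injOn (f := Prod.snd)]
  · exact h2 v
  · intro p hp q hq h
    simp only [Finset.coe_filter, Set.mem_ofPred_eq] at hp hq
    exact Prod.ext (hp.2.trans hq.2.symm) h

section
variable {A : ℕ}

theorem card_descendants_le (hA : 1 ≤ A) {g c u : ℕ} (hc : c ≤ g) (s : Finset (Node A))
    (hs : ∀ v ∈ s, v.gen = g ∧ v.anc c = u) : s.card ≤ A ^ (g - c) := by
  have hpos : 0 < A ^ (g - c) := by positivity
  have : s.card ≤ (Finset.Ico (u * A ^ (g - c)) ((u + 1) * A ^ (g - c))).card := by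
    refine Finset.card_le_card_of_injOn (fun v => v.anc g) ?_ ?_
    · intro v hv
      obtain ⟨h1, h2⟩ := hs v hv
      rw [← v.anc_div hc h1.ge, Nat.div_eq_iff hpos] at h2
      change v.anc g ∈ _
      rw [Finset.coe_Ico, Set.mem_Ico, add_mul, one_mul]
      omega
    · intro v hv w hw h
      have hv := (hs v hv).1
      have hw := (hs w hw).1
      exact Node.ext_anc (hv.trans hw.symm) (by rw [hv]; exact h)
  rwa [Nat.card_Ico, ← Nat.sub_mul, Nat.add_sub_cancel_left, one_mul] at this

/-- The positions form an interval of length `A ^ (g - c)` from which the descendants of the child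
`x`, an interval of length `A ^ (g - c - 1)`, are removed. -/
theorem card_descendants_off_branch_le (hA : 1 ≤ A) {g c u x : ℕ} (hc : c < g) (hx : x / A = u)
    (s : Finset (Node A)) (hs : ∀ v ∈ s, v.gen = g ∧ v.anc c = u ∧ v.anc (c + 1) ≠ x) :
    s.card ≤ (A - 1) * A ^ (g - c - 1) := by
  have hpos : 0 < A ^ (g - c) := by positivity
  have hpos' : 0 < A ^ (g - c - 1) := by positivity
  have hpow : A ^ (g - c) = A * A ^ (g - c - 1) := by
    rw [← pow_succ']; congr 1; omega
  have : s.card ≤ (Finset.Ico (u * A ^ (g - c)) ((u + 1) * A ^ (g - c)) \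
      Finset.Ico (x * A ^ (g - c - 1)) ((x + 1) * A ^ (g - c - 1))).card := by
    refine Finset.card_le_card_of_injOn (fun v => v.anc g) ?_ ?_
    · intro v hv
      obtain ⟨h1, h2, h3⟩ := hs v hv
      rw [← v.anc_div hc.le h1.ge, Nat.div_eq_iff hpos] at h2
      rw [← v.anc_div (Nat.succ_le_of_lt hc) h1.ge, Ne, Nat.succ_eq_add_one, ← Nat.sub_sub,
        Nat.div_eq_iff hpos'] at h3
      change v.anc g ∈ _
      rw [Finset.coe_sdiff, Finset.coe_Ico, Finset.coe_Ico, Set.mem_sdiff, Set.mem_Ico,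
        Set.mem_Ico, add_mul, add_mul, one_mul, one_mul]
      omega
    · intro v hv w hw h
      have hv := (hs v hv).1
      have hw := (hs w hw).1
      exact Node.ext_anc (hv.trans hw.symm) (by rw [hv]; exact h)
  rw [Finset.card_sdiff_of_subset, Nat.card_Ico, Nat.card_Ico, ← Nat.sub_mul, ← Nat.sub_mul,
    Nat.add_sub_cancel_left, Nat.add_sub_cancel_left, one_mul, one_mul, hpow] at this
  · rwa [Nat.sub_mul, one_mul]
  · rw [hpow, ← mul_assoc, ← mul_assoc]
    rw [Nat.div_eq_iff (by omega)] at hx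
    refine Finset.Ico_subset_Ico (Nat.mul_le_mul_right _ hx.1) (Nat.mul_le_mul_right _ ?_)
    rw [add_mul]
    omega

theorem card_le_sum_pow (hA : 1 ≤ A) {L P r : ℕ} (s : Finset (Node A))
    (hs : ∀ v ∈ s, L ≤ v.gen ∧ v.gen ≤ L + P - 1 ∧ v.anc L = r) (hP : 1 ≤ P) :
    s.card ≤ ∑ a ∈ Finset.range P, A ^ a := by
  have hsub : s ⊆ (Finset.range P).biUnion fun a => s.filter fun v => v.gen = L + a := by
    intro v hv
    have := hs v hv
    simp only [Finset.mem_biUnion, Finset.mem_range, Finset.mem_filter]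
    exact ⟨v.gen - L, by omega, hv, by omega⟩
  refine (Finset.card_le_card hsub).trans (Finset.card_biUnion_le.trans
    (Finset.sum_le_sum fun a _ => ?_))
  have := card_descendants_le hA (g := L + a) (c := L) (u := r) (by omega)
    (s.filter fun v => v.gen = L + a) (fun v hv => by
      rw [Finset.mem_filter] at hv
      exact ⟨hv.2, (hs v hv.1).2.2⟩)
  rwa [Nat.add_sub_cancel_left] at this

/-- Pairs are sorted by the depth `h` of the meeting node and the depths `i + j = l` of the two
nodes below it. There are at most `A ^ (h + i)` first nodes; if `i, j ≥ 1`, the second must leave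
the meeting node through another child, which leaves `(A - 1) * A ^ (j - 1)` choices. -/
theorem card_pairs_le_numPairs (hA : 1 ≤ A) {L P r l : ℕ} (hP : 1 ≤ P) (hl : 1 ≤ l)
    (s : Finset (Node A)) (hs : ∀ v ∈ s, L ≤ v.gen ∧ v.gen ≤ L + P - 1 ∧ v.anc L = r) :
    ((s ×ˢ s).filter fun p => meetDist p.1 p.2 = l).card ≤ numPairs A P l := by
  classical
  set S := (s ×ˢ s).filter fun p => meetDist p.1 p.2 = l with hS
  have hSmem : ∀ p ∈ S, p.1 ∈ s ∧ p.2 ∈ s ∧ meetDist p.1 p.2 = l := by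
    intro p hp
    rw [hS, Finset.mem_filter, Finset.mem_product] at hp
    exact ⟨hp.1.1, hp.1.2, hp.2⟩
  let F : ℕ → ℕ → ℕ → Finset (Node A × Node A) := fun h i j =>
    S.filter fun p => meet p.1 p.2 = L + h ∧ p.1.gen = L + h + i ∧ p.2.gen = L + h + j
  have hFmem : ∀ h i j, ∀ p ∈ F h i j, p.1 ∈ s ∧ p.2 ∈ s ∧ meet p.1 p.2 = L + h ∧
      p.1.gen = L + h + i ∧ p.2.gen = L + h + j := by
    intro h i j p hp
    rw [Finset.mem_filter] at hp
    have := hSmem p hp.1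
    exact ⟨this.1, this.2.1, hp.2⟩
  have hfst : ∀ h i j, ((F h i j).image Prod.fst).card ≤ A ^ (h + i) := by
    intro h i j
    have := card_descendants_le hA (g := L + h + i) (c := L) (u := r) (by omega)
      ((F h i j).image Prod.fst) (fun v hv => by
        obtain ⟨p, hp, rfl⟩ := Finset.mem_image.1 hv
        have := hFmem h i j p hp
        exact ⟨this.2.2.2.1, (hs _ this.1).2.2⟩)
    rwa [show L + h + i - L = h + i by omega] at this
  have hcard : ∀ h i j, (F h i j).card ≤ A ^ (h + i) * A ^ j := by
    intro h i j
    refine card_le_of_image_fst_snd _ (hfst h i j) fun v => ?_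
    have := card_descendants_le hA (g := L + h + j) (c := L + h) (u := v.anc (L + h)) (by omega)
      (((F h i j).filter fun p => p.1 = v).image Prod.snd) (fun w hw => by
        obtain ⟨p, hp, rfl⟩ := Finset.mem_image.1 hw
        obtain ⟨hp', rfl⟩ := Finset.mem_filter.1 hp
        have := hFmem h i j p hp'
        refine ⟨this.2.2.2.2, ?_⟩
        rw [← this.2.2.1]
        exact anc_meet.symm)
    rwa [Nat.add_sub_cancel_left] at this
  have hcard' : ∀ h i j, 1 ≤ i → 1 ≤ j →
      (F h i j).card ≤ A ^ (h + i) * ((A - 1) * A ^ (j - 1)) := by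
    intro h i j hi hj
    refine card_le_of_image_fst_snd _ (hfst h i j) fun v => ?_
    by_cases hv : v.gen = L + h + i
    · have := card_descendants_off_branch_le hA (g := L + h + j) (c := L + h)
        (u := v.anc (L + h)) (x := v.anc (L + h + 1)) (by omega)
        (by rw [← v.anc_div (Nat.le_succ (L + h)) (by omega)]; simp)
        (((F h i j).filter fun p => p.1 = v).image Prod.snd) (fun w hw => by
          obtain ⟨p, hp, rfl⟩ := Finset.mem_image.1 hw
          obtain ⟨hp', rfl⟩ := Finset.mem_filter.1 hp
          have := hFmem h i j p hp'
          refine ⟨this.2.2.2.2, ?_, fun he => ?_⟩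
          · rw [← this.2.2.1]
            exact anc_meet.symm
          · have := le_meet (by omega) (by omega) he.symm
            omega)
      rwa [Nat.add_sub_cancel_left] at this
    · have : ((F h i j).filter fun p => p.1 = v) = ∅ := by
        refine Finset.filter_eq_empty_iff.2 fun p hp he => hv ?_
        rw [← he]
        exact (hFmem h i j p hp).2.2.2.1
      rw [this]
      simp
  -- The index `i` in `numPairs` starts at `1`, so the term `i = l` also carries the pairs with `i =
  -- 0`; this is its factor `2`.
  let G : ℕ → ℕ → Finset (Node A × Node A) := fun h i =>
    if i = l then F h l 0 ∪ F h 0 l else F h i (l - i)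
  have hsub : S ⊆ (Finset.range (⌊(P : ℚ) - 1 - (l : ℚ) / 2⌋₊ + 1)).biUnion fun h =>
      (Finset.Icc (max 1 (l - (P - 1 - h))) (min l (P - 1 - h))).biUnion fun i => G h i := by
    intro p hp
    obtain ⟨h1, h2, h3⟩ := hSmem p hp
    have g1 := hs _ h1
    have g2 := hs _ h2
    have m1 := meet_le_left (v := p.1) (w := p.2)
    have m2 := meet_le_right (v := p.1) (w := p.2)
    have m3 : L ≤ meet p.1 p.2 := le_meet g1.1 g2.1 (by rw [g1.2.2, g2.2.2])
    unfold meetDist at h3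
    obtain ⟨h, hh⟩ : ∃ h, meet p.1 p.2 = L + h := ⟨_, (Nat.add_sub_cancel' m3).symm⟩
    obtain ⟨i, hi⟩ : ∃ i, p.1.gen = L + h + i := ⟨p.1.gen - (L + h), by omega⟩
    obtain ⟨j, hj⟩ : ∃ j, p.2.gen = L + h + j := ⟨p.2.gen - (L + h), by omega⟩
    have hF : p ∈ F h i j := Finset.mem_filter.2 ⟨hp, hh, hi, hj⟩
    have hlij : l = i + j := by omega
    have hi' : h + i + 1 ≤ P := by omega
    have hj' : h + j + 1 ≤ P := by omega
    simp only [Finset.mem_biUnion, Finset.mem_range, Finset.mem_Icc]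
    -- Adding `h + i + 1 ≤ P` and `h + j + 1 ≤ P` gives `h ≤ P - 1 - l / 2`.
    refine ⟨h, Nat.lt_succ_of_le (Nat.le_floor ?_), ?_⟩
    · have e1 : (h : ℚ) + i + 1 ≤ P := by exact_mod_cast hi'
      have e2 : (h : ℚ) + j + 1 ≤ P := by exact_mod_cast hj'
      have e3 : (l : ℚ) = i + j := by exact_mod_cast hlij
      linarith
    · rcases Nat.eq_zero_or_pos i with rfl | hi0
      · refine ⟨l, ⟨by omega, by omega⟩, ?_⟩
        have : j = l := by omega
        subst this
        simp only [G, if_true]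
        exact Finset.mem_union_right _ hF
      · refine ⟨i, ⟨by omega, by omega⟩, ?_⟩
        by_cases hil : i = l
        · have : j = 0 := by omega
          subst this
          subst hil
          simp only [G, if_true]
          exact Finset.mem_union_left _ hF
        · have : j = l - i := by omega
          subst this
          simp only [G, if_neg hil]
          exact hF
  refine (Finset.card_le_card hsub).trans (Finset.card_biUnion_le.trans ?_)
  refine Finset.sum_le_sum fun h _ => ?_
  rw [Finset.mul_sum]
  refine Finset.card_biUnion_le.trans (Finset.sum_le_sum fun i hi => ?_)
  rw [Finset.mem_Icc] at hi
  by_cases hil : i = l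
  · subst hil
    simp only [G, if_true, lt_irrefl, if_false, mul_one, mul_zero, add_zero]
    refine (Finset.card_union_le _ _).trans ((add_le_add (hcard _ _ _) (hcard _ _ _)).trans ?_)
    refine le_of_eq ?_
    simp only [pow_add, pow_zero]
    ring
  · have hlt : i < l := by omega
    simp only [G, if_neg hil, if_neg (Ne.symm hil), if_pos hlt, mul_one, mul_zero, zero_add]
    refine (hcard' h i (l - i) (by omega) (by omega)).trans (le_of_eq ?_)
    rw [pow_add, mul_assoc]

theorem sum_meetDist_le (hA : 1 ≤ A) {L P r : ℕ} (hP : 1 ≤ P) (s : Finset (Node A))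
    (hs : ∀ v ∈ s, L ≤ v.gen ∧ v.gen ≤ L + P - 1 ∧ v.anc L = r) (g : ℕ → ℝ)
    (hg : ∀ l, 0 ≤ g l) :
    ∑ p ∈ s.offDiag, g (meetDist p.1 p.2) ≤
      ∑ l ∈ Finset.Icc 1 (2 * (P - 1)), g l * (numPairs A P l : ℝ) := by
  have hmaps : ∀ p ∈ s.offDiag, meetDist p.1 p.2 ∈ Finset.Icc 1 (2 * (P - 1)) := by
    intro p hp
    obtain ⟨h1, h2, h3⟩ := Finset.mem_offDiag.1 hp
    have g1 := hs _ h1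
    have g2 := hs _ h2
    have m3 : L ≤ meet p.1 p.2 := le_meet g1.1 g2.1 (by rw [g1.2.2, g2.2.2])
    have := meetDist_pos h3
    rw [Finset.mem_Icc]
    refine ⟨this, ?_⟩
    unfold meetDist
    omega
  rw [← Finset.sum_fiberwise_of_maps_to hmaps]
  refine Finset.sum_le_sum fun l hl => ?_
  rw [Finset.mem_Icc] at hl
  have hcard : ((s.offDiag.filter fun p => meetDist p.1 p.2 = l).card : ℝ) ≤ numPairs A P l := by
    refine Nat.cast_le.2 ((Finset.card_le_card ?_).trans (card_pairs_le_numPairs hA hP hl.1 s hs))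
    refine Finset.filter_subset_filter _ fun p hp => ?_
    obtain ⟨h1, h2, -⟩ := Finset.mem_offDiag.1 hp
    exact Finset.mem_product.2 ⟨h1, h2⟩
  rw [Finset.sum_congr rfl (g := fun _ => g l) fun p hp => by rw [(Finset.mem_filter.1 hp).2],
    Finset.sum_const, nsmul_eq_mul, mul_comm]
  exact mul_le_mul_of_nonneg_left hcard (hg l)

end

/-! ### Covariance inequalities under α-mixing -/

section Covariance
variable {Ω : Type*} {m m₁ m₂ : MeasurableSpace Ω} [m₀ : MeasurableSpace Ω] {μ : Measure Ω}
  [IsProbabilityMeasure μ]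

/-- After conditioning `g` on `m`, the integral is linear in `X`, so over `0 ≤ X ≤ a` it is largest
for `a` times the indicator of the set where the conditional expectation is positive. Bounds on set
integrals therefore suffice. -/
theorem integral_mul_le_of_setIntegral_le (hm : m ≤ m₀) {X g : Ω → ℝ} {a c : ℝ} (ha : 0 ≤ a)
    (hX : StronglyMeasurable[m] X) (hX0 : ∀ᵐ ω ∂μ, 0 ≤ X ω) (hXa : ∀ᵐ ω ∂μ, X ω ≤ a)
    (hg : Integrable g μ) (hc : ∀ S, MeasurableSet[m] S → ∫ ω in S, g ω ∂μ ≤ c) :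
    ∫ ω, X ω * g ω ∂μ ≤ a * c := by
  have hXn : ∀ᵐ ω ∂μ, ‖X ω‖ ≤ a := by
    filter_upwards [hX0, hXa] with ω h0 h1
    rwa [Real.norm_of_nonneg h0]
  have hpull := condExp_stronglyMeasurable_mul_of_bound hm hX hg a hXn
  have hS : MeasurableSet[m] {ω | 0 < (μ[g | m]) ω} :=
    @measurableSet_lt _ _ _ _ _ m _ _ _ _ _ measurable_const
      (stronglyMeasurable_condExp (f := g) (μ := μ) (m := m)).measurable
  have hint : Integrable (μ[g | m]) μ := integrable_condExp
  calc ∫ ω, X ω * g ω ∂μ = ∫ ω, (μ[X * g | m]) ω ∂μ := (integral_condExp hm).symm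
    _ = ∫ ω, X ω * (μ[g | m]) ω ∂μ := integral_congr_ae hpull
    _ ≤ ∫ ω, a * ({ω | 0 < (μ[g | m]) ω}.indicator (μ[g | m]) ω) ∂μ := by
        refine integral_mono_ae ?_ ((hint.indicator (hm _ hS)).const_mul a) ?_
        · exact hint.bdd_mul (hX.mono hm).aestronglyMeasurable hXn
        · filter_upwards [hX0, hXa] with ω h0 h1
          by_cases hω : 0 < (μ[g | m]) ω
          · rw [Set.indicator_of_mem (by exact hω)]
            exact mul_le_mul_of_nonneg_right h1 hω.le
          · rw [Set.indicator_of_notMem (by exact hω), mul_zero]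
            exact mul_nonpos_of_nonneg_of_nonpos h0 (not_lt.1 hω)
    _ = a * ∫ ω in {ω | 0 < (μ[g | m]) ω}, g ω ∂μ := by
        rw [integral_const_mul, integral_indicator (hm _ hS), setIntegral_condExp hm hg hS]
    _ ≤ a * c := mul_le_mul_of_nonneg_left (hc _ hS) ha

theorem abs_integral_mul_le_of_setIntegral_le (hm : m ≤ m₀) {X g : Ω → ℝ} {a c : ℝ} (ha : 0 ≤ a)
    (hX : StronglyMeasurable[m] X) (hX0 : ∀ᵐ ω ∂μ, 0 ≤ X ω) (hXa : ∀ᵐ ω ∂μ, X ω ≤ a)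
    (hg : Integrable g μ) (hc : ∀ S, MeasurableSet[m] S → |∫ ω in S, g ω ∂μ| ≤ c) :
    |∫ ω, X ω * g ω ∂μ| ≤ a * c := by
  refine abs_le'.2 ⟨?_, ?_⟩
  · exact integral_mul_le_of_setIntegral_le hm ha hX hX0 hXa hg
      fun S hS => (le_abs_self _).trans (hc S hS)
  · rw [← integral_neg]
    simp_rw [← mul_neg]
    refine integral_mul_le_of_setIntegral_le hm ha hX hX0 hXa hg.neg fun S hS => ?_
    have := hc S hS
    simp only [integral_neg]
    exact (neg_le_abs _).trans this

/-- The covariance inequality for bounded nonnegative variables. -/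
theorem abs_integral_mul_sub_le (hm₁ : m₁ ≤ m₀) (hm₂ : m₂ ≤ m₀) {X Y : Ω → ℝ} {a b c : ℝ}
    (ha : 0 ≤ a) (hb : 0 ≤ b)
    (hX : StronglyMeasurable[m₁] X) (hX0 : ∀ᵐ ω ∂μ, 0 ≤ X ω) (hXa : ∀ᵐ ω ∂μ, X ω ≤ a)
    (hY : StronglyMeasurable[m₂] Y) (hY0 : ∀ᵐ ω ∂μ, 0 ≤ Y ω) (hYb : ∀ᵐ ω ∂μ, Y ω ≤ b)
    (hc : ∀ S T, MeasurableSet[m₁] S → MeasurableSet[m₂] T →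
      |μ.real (S ∩ T) - μ.real S * μ.real T| ≤ c) :
    |∫ ω, X ω * Y ω ∂μ - (∫ ω, X ω ∂μ) * ∫ ω, Y ω ∂μ| ≤ a * (b * c) := by
  have hXi : Integrable X μ := Integrable.of_bound (hX.mono hm₁).aestronglyMeasurable a (by
    filter_upwards [hX0, hXa] with ω h0 h1
    rwa [Real.norm_of_nonneg h0])
  have hYn : ∀ᵐ ω ∂μ, ‖Y ω‖ ≤ b := by
    filter_upwards [hY0, hYb] with ω h0 h1
    rwa [Real.norm_of_nonneg h0]
  have hYi : Integrable Y μ := Integrable.of_bound (hY.mono hm₂).aestronglyMeasurable b hYn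
  have hXYi : Integrable (fun ω => X ω * Y ω) μ :=
    hXi.mul_bdd (hY.mono hm₂).aestronglyMeasurable hYn
  -- The extremal principle is used twice: here to replace `Y` by an indicator with `S` fixed, and
  -- afterwards to replace `X`. Nonnegativity avoids splitting into signs, so no constant is lost.
  have key : ∀ S, MeasurableSet[m₁] S → |∫ ω in S, (Y ω - ∫ ω, Y ω ∂μ) ∂μ| ≤ b * c := by
    intro S hS
    have hS' := hm₁ _ hS
    have hSi : Integrable (S.indicator fun _ => (1 : ℝ)) μ :=
      (integrable_const 1).indicator hS'
    have := abs_integral_mul_le_of_setIntegral_le hm₂ hb hY hY0 hYb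
      (g := fun ω => S.indicator (fun _ => (1 : ℝ)) ω - μ.real S)
      (hSi.sub (integrable_const _)) (c := c) (fun T hT => by
        rw [integral_sub hSi.integrableOn (integrable_const _), integral_indicator hS',
          Measure.restrict_restrict hS', setIntegral_const, setIntegral_const]
        simp only [smul_eq_mul, mul_one]
        rw [mul_comm (μ.real T)]
        exact hc S T hS hT)
    convert this using 2
    rw [integral_sub hYi.integrableOn (integrable_const _), setIntegral_const]
    simp_rw [mul_sub]
    have e : ∀ ω, Y ω * S.indicator (fun _ => (1 : ℝ)) ω = S.indicator Y ω := by
      intro ω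
      by_cases h : ω ∈ S <;> simp [h]
    simp_rw [e]
    rw [integral_sub (hYi.indicator hS') (hYi.mul_const _), integral_indicator hS',
      integral_mul_const, smul_eq_mul, mul_comm (μ.real S)]
  have := abs_integral_mul_le_of_setIntegral_le hm₁ ha hX hX0 hXa
    (g := fun ω => Y ω - ∫ ω, Y ω ∂μ) (hYi.sub (integrable_const _)) key
  simp_rw [mul_sub] at this
  rwa [integral_sub hXYi (hXi.mul_const _), integral_mul_const] at this

/-- The covariance inequality for bounded centred variables. -/
theorem abs_integral_mul_le_of_centered (hm₁ : m₁ ≤ m₀) (hm₂ : m₂ ≤ m₀) {X Y : Ω → ℝ} {C c : ℝ}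
    (hC : 0 ≤ C) (hX : StronglyMeasurable[m₁] X) (hXC : ∀ᵐ ω ∂μ, |X ω| ≤ C)
    (hY : StronglyMeasurable[m₂] Y) (hYC : ∀ᵐ ω ∂μ, |Y ω| ≤ C)
    (hX0 : ∫ ω, X ω ∂μ = 0) (hY0 : ∫ ω, Y ω ∂μ = 0)
    (hc : ∀ S T, MeasurableSet[m₁] S → MeasurableSet[m₂] T →
      |μ.real (S ∩ T) - μ.real S * μ.real T| ≤ c) :
    |∫ ω, X ω * Y ω ∂μ| ≤ 4 * C ^ 2 * c := by
  have hXi : Integrable X μ := Integrable.of_bound (hX.mono hm₁).aestronglyMeasurable C hXC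
  have hYi : Integrable Y μ := Integrable.of_bound (hY.mono hm₂).aestronglyMeasurable C hYC
  have hXYi : Integrable (fun ω => X ω * Y ω) μ :=
    hXi.mul_bdd (hY.mono hm₂).aestronglyMeasurable hYC
  -- Shifting by `C` leaves the covariance unchanged and puts both variables in `[0, 2 * C]`, whence
  -- the factor `4 * C ^ 2`.
  have := abs_integral_mul_sub_le (μ := μ) (X := fun ω => X ω + C) (Y := fun ω => Y ω + C)
    (a := 2 * C) (b := 2 * C) (c := c) hm₁ hm₂ (by linarith) (by linarith)
    (hX.add stronglyMeasurable_const)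
    (by filter_upwards [hXC] with ω h; linarith [(abs_le.1 h).1])
    (by filter_upwards [hXC] with ω h; linarith [(abs_le.1 h).2])
    (hY.add stronglyMeasurable_const)
    (by filter_upwards [hYC] with ω h; linarith [(abs_le.1 h).1])
    (by filter_upwards [hYC] with ω h; linarith [(abs_le.1 h).2]) hc
  have e : ∀ ω, (X ω + C) * (Y ω + C) = X ω * Y ω + (C * X ω + (C * Y ω + C * C)) := by
    intro ω; ring
  simp_rw [e] at this
  rw [integral_add hXYi (by fun_prop), integral_add (by fun_prop) (by fun_prop),
    integral_add (by fun_prop) (by fun_prop), integral_add hXi (by fun_prop),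
    integral_add hYi (by fun_prop), integral_const_mul, integral_const_mul, hX0, hY0] at this
  simp only [integral_const, probReal_univ, smul_eq_mul] at this
  convert this using 1
  · congr 1; ring
  · ring

end Covariance

/-! ### Mixing coefficients and decoupling of products -/

section Mixing
variable {V Ω : Type*} {Z : V → Ω → ℝ}

theorem sigmaField_mono {I J : Set V} (h : I ⊆ J) : sigmaField Z I ≤ sigmaField Z J :=
  biSup_mono h

theorem measurable_sigmaField {I : Set V} {v : V} (hv : v ∈ I) :
    Measurable[sigmaField Z I] (Z v) :=
  measurable_iff_comap_le.2 (le_biSup (fun v => MeasurableSpace.comap (Z v) inferInstance) hv)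

variable [MeasurableSpace Ω] {G : SimpleGraph V} {μ : Measure Ω}

theorem sigmaField_le (hZ : ∀ v, Measurable (Z v)) (I : Set V) :
    sigmaField Z I ≤ (inferInstance : MeasurableSpace Ω) :=
  iSup₂_le fun v _ => (hZ v).comap_le

theorem alphaMixing_nonneg (n : ℕ) : 0 ≤ alphaMixing G μ Z n :=
  Real.sSup_nonneg (by rintro x ⟨-, -, -, S, T, -, -, rfl⟩; exact abs_nonneg _)

variable [IsProbabilityMeasure μ]

theorem abs_real_inter_sub_le_one (S T : Set Ω) :
    |μ.real (S ∩ T) - μ.real S * μ.real T| ≤ 1 := by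
  have h1 := measureReal_nonneg (μ := μ) (s := S)
  have h2 := measureReal_nonneg (μ := μ) (s := T)
  have h3 := measureReal_nonneg (μ := μ) (s := S ∩ T)
  have h4 := measureReal_le_one (μ := μ) (s := S)
  have h5 := measureReal_le_one (μ := μ) (s := T)
  have h6 := measureReal_le_one (μ := μ) (s := S ∩ T)
  rw [abs_le]
  constructor <;> nlinarith

theorem le_alphaMixing {n : ℕ} {I J : Set V} (h : (n : ℕ∞) ≤ setDist G I J) {S T : Set Ω}
    (hS : MeasurableSet[sigmaField Z I] S) (hT : MeasurableSet[sigmaField Z J] T) :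
    |μ.real (S ∩ T) - μ.real S * μ.real T| ≤ alphaMixing G μ Z n := by
  refine le_csSup ⟨1, ?_⟩ ⟨I, J, h, S, T, hS, hT, rfl⟩
  rintro x ⟨-, -, -, S, T, -, -, rfl⟩
  exact abs_real_inter_sub_le_one S T

theorem setDist_singleton (v w : V) : setDist G {v} {w} = G.edist v w := by
  simp [setDist]

theorem le_setDist_iff {n : ℕ∞} {I J : Set V} :
    n ≤ setDist G I J ↔ ∀ v ∈ I, ∀ w ∈ J, n ≤ G.edist v w := by
  simp [setDist]

/-- Decoupling of a product of functions of well separated parts of a mixing field. -/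
theorem integral_prod_le (hZ : ∀ v, Measurable (Z v)) {W : ℕ → Ω → ℝ} {I : ℕ → Set V} {n : ℕ}
    {M : ℝ} (hM : 1 ≤ M) (hW : ∀ b, StronglyMeasurable[sigmaField Z (I b)] (W b))
    (hW0 : ∀ b, ∀ᵐ ω ∂μ, 0 ≤ W b ω) (hWM : ∀ b, ∀ᵐ ω ∂μ, W b ω ≤ M)
    (hW1 : ∀ b, 1 ≤ ∫ ω, W b ω ∂μ)
    (hfar : ∀ i j, i < j → (n : ℕ∞) ≤ setDist G (I i) (I j)) (k : ℕ) :
    ∫ ω, ∏ b ∈ Finset.range k, W b ω ∂μ ≤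
      (∏ b ∈ Finset.range k, ∫ ω, W b ω ∂μ) * (1 + alphaMixing G μ Z n * k * M ^ k) := by
  have hα := alphaMixing_nonneg (G := G) (μ := μ) (Z := Z) n
  induction k with
  | zero => simp
  | succ k ih =>
    have hcov := abs_integral_mul_sub_le (μ := μ) (X := fun ω => ∏ b ∈ Finset.range k, W b ω)
      (Y := W k) (a := M ^ k) (b := M) (c := alphaMixing G μ Z n)
      (sigmaField_le hZ (⋃ i ∈ Finset.range k, I i)) (sigmaField_le hZ (I k))
      (by positivity) (by positivity)
      (Finset.stronglyMeasurable_fun_prod _ fun b hb =>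
        (hW b).mono (sigmaField_mono (Set.subset_biUnion_of_mem (u := I) hb)))
      (by
        filter_upwards [ae_all_iff.2 hW0] with ω h0
        exact Finset.prod_nonneg fun b _ => h0 b)
      (by
        filter_upwards [ae_all_iff.2 hW0, ae_all_iff.2 hWM] with ω h0 h1
        refine (Finset.prod_le_prod (fun b _ => h0 b) fun b _ => h1 b).trans ?_
        simp)
      (hW k) (hW0 k) (hWM k)
      (fun S T hS hT => le_alphaMixing (by
        rw [le_setDist_iff]
        intro v hv w hw
        obtain ⟨i, hi, hv⟩ := Set.mem_iUnion₂.1 hv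
        exact le_setDist_iff.1 (hfar i k (Finset.mem_range.1 hi)) v hv w hw) hS hT)
    -- Since all expectations are at least `1`, the additive covariance error is also a relative one
    -- and can be absorbed into the product.
    have hprod : 1 ≤ ∏ b ∈ Finset.range k, ∫ ω, W b ω ∂μ :=
      by
      simpa using Finset.prod_le_prod (s := Finset.range k) (f := fun _ => (1 : ℝ))
        (fun _ _ => zero_le_one) fun b _ => hW1 b
    have hMk : (1 : ℝ) ≤ M ^ k := one_le_pow₀ hM
    simp_rw [Finset.prod_range_succ]
    set α := alphaMixing G μ Z n
    set p := ∏ b ∈ Finset.range k, ∫ ω, W b ω ∂μ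
    set w := ∫ ω, W k ω ∂μ
    have hw : 1 ≤ w := hW1 k
    have hpw : 1 ≤ p * w := one_le_mul_of_one_le_of_one_le hprod hw
    calc ∫ ω, (∏ b ∈ Finset.range k, W b ω) * W k ω ∂μ
        ≤ (∫ ω, ∏ b ∈ Finset.range k, W b ω ∂μ) * w + M ^ k * (M * α) := by
          have := (abs_le.1 hcov).2
          linarith
      _ ≤ p * (1 + α * k * M ^ k) * w + p * w * (M ^ k * (M * α)) := by
          refine add_le_add (mul_le_mul_of_nonneg_right ih (by linarith)) ?_
          exact le_mul_of_one_le_left (by positivity) hpw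
      _ = p * w * (1 + α * k * M ^ k + α * M ^ (k + 1)) := by ring
      _ ≤ p * w * (1 + α * k * M ^ (k + 1) + α * M ^ (k + 1)) := by
          have : M ^ k ≤ M ^ (k + 1) := pow_le_pow_right₀ hM (Nat.le_succ k)
          gcongr
      _ = p * w * (1 + α * ((k + 1 : ℕ) : ℝ) * M ^ (k + 1)) := by push_cast; ring

end Mixing

/-! ### The decoupling error as an exponential -/

/-- Write `α = x ^ (n + 2)`. One factor `x` pairs with `m ≤ 2 * n`; the others absorb `e ^ m`,
because `x * e ≤ e ^ x` gives `(x * e) ^ (n + 1) ≤ e ^ (2 * n * x)`. What remains is `1 + y * e ^ y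
≤ e ^ (2 * y)` with `y = 2 * n * x`, which explains the threshold `4`. -/
theorem one_add_mul_exp_le {α n c : ℝ} {m : ℕ} (h0 : 0 ≤ α) (hn : 1 ≤ n)
    (hm : (m : ℝ) ≤ n + 1) (hc : 4 ≤ c) :
    1 + α * m * Real.exp 1 ^ m ≤ Real.exp (c * α ^ (1 / (n + 2)) * n) := by
  set x := α ^ (1 / (n + 2)) with hx
  have hx0 : 0 ≤ x := Real.rpow_nonneg h0 _
  have hα : α = x * x ^ (n + 1) := by
    rw [← Real.rpow_one_add' hx0 (by linarith), hx, ← Real.rpow_mul h0, one_div,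
      show 1 + (n + 1) = n + 2 by ring, inv_mul_cancel₀ (by linarith), Real.rpow_one]
  have hpow : x ^ (n + 1) * Real.exp 1 ^ m ≤ Real.exp (2 * (n * x)) := by
    calc x ^ (n + 1) * Real.exp 1 ^ m ≤ x ^ (n + 1) * Real.exp 1 ^ (n + 1) := by
          refine mul_le_mul_of_nonneg_left ?_ (Real.rpow_nonneg hx0 _)
          rw [← Real.rpow_natCast]
          exact Real.rpow_le_rpow_of_exponent_le (Real.one_le_exp zero_le_one) hm
      _ = (x * Real.exp 1) ^ (n + 1) := (Real.mul_rpow hx0 (Real.exp_pos _).le).symm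
      _ ≤ Real.exp x ^ (n + 1) := by
          refine Real.rpow_le_rpow (by positivity) ?_ (by linarith)
          rw [mul_comm]
          exact Real.exp_one_mul_le_exp
      _ = Real.exp (x * (n + 1)) := (Real.exp_mul _ _).symm
      _ ≤ Real.exp (2 * (n * x)) := Real.exp_le_exp.2 (by nlinarith)
  have hy : 0 ≤ n * x := by positivity
  calc 1 + α * m * Real.exp 1 ^ m
      = 1 + (m * x) * (x ^ (n + 1) * Real.exp 1 ^ m) := by rw [hα]; ring
    _ ≤ 1 + (2 * (n * x)) * Real.exp (2 * (n * x)) := by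
        have : m * x ≤ 2 * (n * x) := by nlinarith
        gcongr
    _ ≤ Real.exp (2 * (n * x)) * (2 * (n * x) + 1) := by
        have := Real.one_le_exp (x := 2 * (n * x)) (by positivity)
        linarith
    _ ≤ Real.exp (2 * (n * x)) * Real.exp (2 * (n * x)) := by
        gcongr
        exact Real.add_one_le_exp _
    _ = Real.exp (4 * (n * x)) := by rw [← Real.exp_add]; ring_nf
    _ ≤ Real.exp (c * x * n) := Real.exp_le_exp.2 (by nlinarith)

/-! ### Moments of subtree sums and block sums -/

/-- The sum of the field over the subtree that is rooted at the `k`-th node, counted from `0`, of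
generation `L`. -/
noncomputable def subtreeSum {A : ℕ} {Ω : Type*} (Z : Node A → Ω → ℝ) (L P k : ℕ) (ω : Ω) : ℝ :=
  ∑ v ∈ (subtree_finite A L (k + 1) P).toFinset, Z v ω

theorem stripSum_eq {A : ℕ} {Ω : Type*} {Z : Node A → Ω → ℝ} (hA : 1 ≤ A) (L P : ℕ) (ω : Ω) :
    stripSum Z L P ω = ∑ k ∈ Finset.range (A ^ L), subtreeSum Z L P k ω := by
  have : (strip_finite A L P).toFinset = (Finset.range (A ^ L)).biUnion
      fun k => (subtree_finite A L (k + 1) P).toFinset := by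
    ext v
    simp only [strip, Set.Finite.mem_toFinset, Set.mem_iUnion, Finset.mem_Icc,
      Finset.mem_biUnion, Finset.mem_range, exists_prop]
    constructor
    · rintro ⟨k, ⟨h1, h2⟩, h3⟩
      exact ⟨k - 1, by omega, by rwa [Nat.sub_add_cancel h1]⟩
    · rintro ⟨k, h1, h2⟩
      exact ⟨k + 1, ⟨by omega, by omega⟩, h2⟩
  rw [stripSum, this, Finset.sum_biUnion]
  · rfl
  · intro k _ k' _ hkk
    refine Finset.disjoint_left.2 fun v hv hv' => hkk ?_
    rw [Set.Finite.mem_toFinset, mem_subtree_iff hA (by omega)] at hv hv'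
    have h1 := hv.2.2
    have h2 := hv'.2.2
    omega

section
variable {Ω : Type*} [MeasurableSpace Ω] {μ : Measure Ω} [IsProbabilityMeasure μ]
  {A : ℕ} {Z : Node A → Ω → ℝ} {C σ : ℝ}

theorem integral_sq_sum_le (hA : 1 ≤ A) (hC : 0 ≤ C) (hZ : ∀ v, Measurable (Z v))
    (hZ_mean : ∀ v, ∫ ω, Z v ω ∂μ = 0) (hZC : ∀ v, ∀ᵐ ω ∂μ, |Z v ω| ≤ C)
    (hZ_var : ∀ v, variance (Z v) μ ≤ σ ^ 2) {L P r : ℕ} (hP : 1 ≤ P) (s : Finset (Node A))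
    (hs : ∀ v ∈ s, L ≤ v.gen ∧ v.gen ≤ L + P - 1 ∧ v.anc L = r) :
    ∫ ω, (∑ v ∈ s, Z v ω) ^ 2 ∂μ ≤ (∑ a ∈ Finset.range P, (A : ℝ) ^ a) * σ ^ 2 +
      4 * C ^ 2 * ∑ k ∈ Finset.Icc 1 (2 * (P - 1)),
        alphaMixing (tree A) μ Z k * (numPairs A P k : ℝ) := by
  have hint : ∀ v w, Integrable (fun ω => Z v ω * Z w ω) μ := fun v w =>
    (Integrable.of_bound (hZ v).aestronglyMeasurable C (hZC v)).mul_bdd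
      (hZ w).aestronglyMeasurable (hZC w)
  have hexp : ∀ ω, (∑ v ∈ s, Z v ω) ^ 2 =
      ∑ v ∈ s, Z v ω * Z v ω + ∑ p ∈ s.offDiag, Z p.1 ω * Z p.2 ω := by
    intro ω
    rw [sq, Finset.sum_mul_sum, ← Finset.sum_product', ← Finset.diag_union_offDiag,
      Finset.sum_union (Finset.disjoint_diag_offDiag _), Finset.sum_diag]
  simp_rw [hexp]
  rw [integral_add (integrable_finsetSum _ fun v _ => hint v v)
    (integrable_finsetSum _ fun p _ => hint p.1 p.2),
    integral_finsetSum _ fun v _ => hint v v,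
    integral_finsetSum _ fun p _ => hint p.1 p.2]
  refine add_le_add ?_ ?_
  · calc ∑ v ∈ s, ∫ ω, Z v ω * Z v ω ∂μ ≤ ∑ v ∈ s, σ ^ 2 := by
          refine Finset.sum_le_sum fun v _ => le_trans (le_of_eq ?_) (hZ_var v)
          rw [variance_of_integral_eq_zero (hZ v).aemeasurable (hZ_mean v)]
          exact integral_congr_ae (ae_of_all _ fun ω => (sq _).symm)
      _ = s.card * σ ^ 2 := by rw [Finset.sum_const, nsmul_eq_mul]
      _ ≤ _ := by
          refine mul_le_mul_of_nonneg_right ?_ (sq_nonneg σ)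
          exact_mod_cast card_le_sum_pow hA s hs hP
  · rw [Finset.mul_sum]
    simp_rw [← mul_assoc]
    refine le_trans (Finset.sum_le_sum fun p _ => ?_) (sum_meetDist_le hA hP s hs
      (fun l => 4 * C ^ 2 * alphaMixing (tree A) μ Z l)
      fun l => mul_nonneg (by positivity) (alphaMixing_nonneg l))
    have hm : ∀ v, StronglyMeasurable[sigmaField Z {v}] (Z v) := fun v =>
      (measurable_sigmaField (Set.mem_singleton v)).stronglyMeasurable
    have hα : ∀ S T, MeasurableSet[sigmaField Z {p.1}] S → MeasurableSet[sigmaField Z {p.2}] T →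
        |μ.real (S ∩ T) - μ.real S * μ.real T| ≤
          alphaMixing (tree A) μ Z (meetDist p.1 p.2) := fun S T hS hT =>
      le_alphaMixing (by rw [setDist_singleton]; exact meetDist_le_edist _ _) hS hT
    have := abs_integral_mul_le_of_centered (m₁ := sigmaField Z {p.1}) (m₂ := sigmaField Z {p.2})
      (μ := μ) (sigmaField_le hZ _) (sigmaField_le hZ _) hC (hm p.1) (hZC _) (hm p.2) (hZC _)
      (hZ_mean _) (hZ_mean _) hα
    exact (le_abs_self _).trans this

/-- The exponential moment of a centred variable `U` with `|δ U| ≤ 1`. -/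
theorem integral_exp_mul_bounds {U : Ω → ℝ} {δ : ℝ} (hU : Measurable U)
    (hU0 : ∫ ω, U ω ∂μ = 0) (hUi : Integrable U μ) (hU2 : Integrable (fun ω => U ω ^ 2) μ)
    (hδ : ∀ᵐ ω ∂μ, |δ * U ω| ≤ 1) :
    1 ≤ ∫ ω, Real.exp (δ * U ω) ∂μ ∧
      ∫ ω, Real.exp (δ * U ω) ∂μ ≤ Real.exp (δ ^ 2 * ∫ ω, U ω ^ 2 ∂μ) := by
  have hexp : Integrable (fun ω => Real.exp (δ * U ω)) μ :=
    Integrable.of_bound (by fun_prop) (Real.exp 1) (by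
      filter_upwards [hδ] with ω h
      rw [Real.norm_of_nonneg (Real.exp_pos _).le]
      exact Real.exp_le_exp.2 (abs_le.1 h).2)
  have hlin : Integrable (fun ω => δ * U ω + 1) μ := by fun_prop
  have hlin1 : ∫ ω, (δ * U ω + 1) ∂μ = 1 := by
    rw [integral_add (by fun_prop) (by fun_prop), integral_const_mul, hU0]
    simp
  constructor
  · calc (1 : ℝ) = ∫ ω, (δ * U ω + 1) ∂μ := hlin1.symm
      _ ≤ _ := integral_mono hlin hexp fun ω => Real.add_one_le_exp _
  · calc ∫ ω, Real.exp (δ * U ω) ∂μ ≤ ∫ ω, ((δ * U ω + 1) + δ ^ 2 * U ω ^ 2) ∂μ := by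
          refine integral_mono_ae hexp (hlin.add (hU2.const_mul _)) ?_
          filter_upwards [hδ] with ω h
          have := (abs_le.1 (Real.abs_exp_sub_one_sub_id_le h)).2
          nlinarith
      _ = δ ^ 2 * ∫ ω, U ω ^ 2 ∂μ + 1 := by
          rw [integral_add hlin (hU2.const_mul _), hlin1, integral_const_mul, add_comm]
      _ ≤ _ := Real.add_one_le_exp _

/-- Each block factor lies in `[0, e]` and has mean at least `1` by Jensen-type convexity, so the
decoupling applies with `M = e`; the separation of the positions supplies the distance. -/
theorem integral_exp_blocks_le (hA : 2 ≤ A) (hC : 0 < C) (hZ : ∀ v, Measurable (Z v))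
    (hZ_mean : ∀ v, ∫ ω, Z v ω ∂μ = 0) (hZC : ∀ v, ∀ᵐ ω ∂μ, |Z v ω| ≤ C)
    (hZ_var : ∀ v, variance (Z v) μ ≤ σ ^ 2) {L P P₂ Q₂ : ℕ} (hP : 1 ≤ P) (hQ₂ : 1 ≤ Q₂)
    {δ : ℝ} (hδ : |δ| * (P₂ * ((∑ a ∈ Finset.range P, (A : ℝ) ^ a) * C)) ≤ 1)
    {B : ℕ → Finset ℕ} (hB : ∀ b, (B b).card ≤ P₂)
    (hsep : ∀ i j, i < j → ∀ k ∈ B i, ∀ k' ∈ B j, k + Q₂ < k') (m : ℕ) :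
    ∫ ω, Real.exp (δ * ∑ b ∈ Finset.range m, ∑ k ∈ B b, subtreeSum Z L P k ω) ∂μ ≤
      Real.exp (m * (δ ^ 2 * ((P₂ : ℝ) ^ 2 * ((∑ a ∈ Finset.range P, (A : ℝ) ^ a) * σ ^ 2 +
        4 * C ^ 2 * ∑ k ∈ Finset.Icc 1 (2 * (P - 1)),
          alphaMixing (tree A) μ Z k * (numPairs A P k : ℝ))))) *
      (1 + alphaMixing (tree A) μ Z (2 * ⌈Real.log Q₂ / Real.log A⌉₊) * m *
        Real.exp 1 ^ m) := by
  set D := ∑ a ∈ Finset.range P, (A : ℝ) ^ a with hD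
  set K := D * σ ^ 2 + 4 * C ^ 2 * ∑ k ∈ Finset.Icc 1 (2 * (P - 1)),
    alphaMixing (tree A) μ Z k * (numPairs A P k : ℝ) with hK
  have hD0 : 0 ≤ D := by positivity
  have hK0 : 0 ≤ K := by
    refine add_nonneg (by positivity) (mul_nonneg (by positivity) (Finset.sum_nonneg fun k _ => ?_))
    exact mul_nonneg (alphaMixing_nonneg k) (Nat.cast_nonneg _)
  have hs : ∀ k, ∀ v ∈ (subtree_finite A L (k + 1) P).toFinset,
      L ≤ v.gen ∧ v.gen ≤ L + P - 1 ∧ v.anc L = k := by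
    intro k v hv
    rwa [Set.Finite.mem_toFinset, mem_subtree_iff (by omega) (by omega)] at hv
  have hZi : ∀ v, Integrable (Z v) μ := fun v =>
    Integrable.of_bound (hZ v).aestronglyMeasurable C (hZC v)
  have hXmeas : ∀ k, Measurable (subtreeSum Z L P k) := fun k =>
    Finset.measurable_fun_sum _ fun v _ => hZ v
  have hXbd : ∀ᵐ ω ∂μ, ∀ k, |subtreeSum Z L P k ω| ≤ D * C := by
    have hZC' : ∀ᵐ ω ∂μ, ∀ k, ∀ v ∈ (subtree_finite A L (k + 1) P).toFinset, |Z v ω| ≤ C :=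
      ae_all_iff.2 fun k => (Finset.eventually_all _).2 fun v _ => hZC v
    filter_upwards [hZC'] with ω h k
    refine (Finset.abs_sum_le_sum_abs _ _).trans ((Finset.sum_le_sum (h k)).trans ?_)
    rw [Finset.sum_const, nsmul_eq_mul]
    refine mul_le_mul_of_nonneg_right ?_ hC.le
    rw [hD]
    exact_mod_cast card_le_sum_pow (by omega) _ (hs k) hP
  have hXi : ∀ k, Integrable (subtreeSum Z L P k) μ := fun k =>
    integrable_finsetSum _ fun v _ => hZi v
  have hX2 : ∀ k, Integrable (fun ω => subtreeSum Z L P k ω ^ 2) μ := fun k =>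
    Integrable.of_bound ((hXmeas k).pow_const 2).aestronglyMeasurable ((D * C) ^ 2) (by
      filter_upwards [hXbd] with ω h
      rw [norm_pow]
      exact pow_le_pow_left₀ (norm_nonneg _) (h k) 2)
  let U : ℕ → Ω → ℝ := fun b ω => ∑ k ∈ B b, subtreeSum Z L P k ω
  have hUmeas : ∀ b, Measurable (U b) := fun b => Finset.measurable_fun_sum _ fun k _ => hXmeas k
  have hUi : ∀ b, Integrable (U b) μ := fun b => integrable_finsetSum _ fun k _ => hXi k
  have hU0 : ∀ b, ∫ ω, U b ω ∂μ = 0 := by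
    intro b
    rw [integral_finsetSum _ fun k _ => hXi k]
    refine Finset.sum_eq_zero fun k _ => ?_
    simp only [subtreeSum]
    rw [integral_finsetSum _ fun v _ => hZi v]
    exact Finset.sum_eq_zero fun v _ => hZ_mean v
  -- Cauchy–Schwarz costs one factor `P₂`, and summing over at most `P₂` subtrees costs another; no
  -- mixing between subtrees of the same block is exploited.
  have hUsq : ∀ b ω, U b ω ^ 2 ≤ P₂ * ∑ k ∈ B b, subtreeSum Z L P k ω ^ 2 := by
    intro b ω
    refine sq_sum_le_card_mul_sum_sq.trans ?_
    refine mul_le_mul_of_nonneg_right (by exact_mod_cast hB b) ?_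
    exact Finset.sum_nonneg fun k _ => sq_nonneg _
  have hBi : ∀ b, Integrable (fun ω => (P₂ : ℝ) * ∑ k ∈ B b, subtreeSum Z L P k ω ^ 2) μ :=
    fun b => (integrable_finsetSum _ fun k _ => hX2 k).const_mul _
  have hU2 : ∀ b, Integrable (fun ω => U b ω ^ 2) μ := fun b =>
    (hBi b).mono' ((hUmeas b).pow_const 2).aestronglyMeasurable (ae_of_all _ fun ω => by
      rw [Real.norm_of_nonneg (sq_nonneg _)]
      exact hUsq b ω)
  have hU2K : ∀ b, ∫ ω, U b ω ^ 2 ∂μ ≤ (P₂ : ℝ) ^ 2 * K := by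
    intro b
    refine (integral_mono (hU2 b) (hBi b) (hUsq b)).trans ?_
    rw [integral_const_mul, integral_finsetSum _ fun k _ => hX2 k, sq, mul_assoc]
    refine mul_le_mul_of_nonneg_left ?_ (Nat.cast_nonneg _)
    refine (Finset.sum_le_sum (g := fun _ => K) fun k _ => ?_).trans ?_
    · exact integral_sq_sum_le (by omega) hC.le hZ hZ_mean hZC hZ_var hP _ (hs k)
    · rw [Finset.sum_const, nsmul_eq_mul]
      exact mul_le_mul_of_nonneg_right (by exact_mod_cast hB b) hK0
  have hUδ : ∀ b, ∀ᵐ ω ∂μ, |δ * U b ω| ≤ 1 := by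
    intro b
    filter_upwards [hXbd] with ω h
    rw [abs_mul]
    refine le_trans (mul_le_mul_of_nonneg_left ?_ (abs_nonneg δ)) hδ
    refine (Finset.abs_sum_le_sum_abs _ _).trans ((Finset.sum_le_sum fun k _ => h k).trans ?_)
    rw [Finset.sum_const, nsmul_eq_mul]
    exact mul_le_mul_of_nonneg_right (by exact_mod_cast hB b) (by positivity)
  have hW := fun b => integral_exp_mul_bounds (hUmeas b) (hU0 b) (hUi b) (hU2 b) (hUδ b)
  have hmain := integral_prod_le (μ := μ) (G := tree A) (Z := Z)
    (W := fun b ω => Real.exp (δ * U b ω))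
    (I := fun b => ⋃ k ∈ B b, subtree A L (k + 1) P)
    (n := 2 * ⌈Real.log Q₂ / Real.log A⌉₊) (M := Real.exp 1) hZ (Real.one_le_exp zero_le_one)
    (fun b => by
      refine Measurable.stronglyMeasurable (Real.measurable_exp.comp ?_)
      refine Measurable.const_mul (Finset.measurable_fun_sum _ fun k hk => ?_) δ
      refine Finset.measurable_fun_sum _ fun v hv => measurable_sigmaField ?_
      rw [Set.Finite.mem_toFinset] at hv
      exact Set.mem_biUnion hk hv)
    (fun b => ae_of_all _ fun ω => (Real.exp_pos _).le)
    (fun b => by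
      filter_upwards [hUδ b] with ω h
      exact Real.exp_le_exp.2 (abs_le.1 h).2)
    (fun b => (hW b).1)
    (fun i j hij => by
      rw [le_setDist_iff]
      intro v hv w hw
      obtain ⟨k, hk, hv⟩ := Set.mem_iUnion₂.1 hv
      obtain ⟨k', hk', hw⟩ := Set.mem_iUnion₂.1 hw
      have := hsep i j hij k hk k' hk'
      refine le_trans ?_ (meetDist_le_edist v w)
      exact_mod_cast le_meetDist_of_far hA hQ₂ (by omega) (by omega) (by omega) hv hw) m
  have hα := alphaMixing_nonneg (G := tree A) (μ := μ) (Z := Z)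
    (2 * ⌈Real.log Q₂ / Real.log A⌉₊)
  simp_rw [Finset.mul_sum (Finset.range m), Real.exp_sum]
  refine hmain.trans (mul_le_mul_of_nonneg_right ?_ (by positivity))
  calc ∏ b ∈ Finset.range m, ∫ ω, Real.exp (δ * U b ω) ∂μ
      ≤ ∏ b ∈ Finset.range m, Real.exp (δ ^ 2 * ((P₂ : ℝ) ^ 2 * K)) := by
        refine Finset.prod_le_prod (fun b _ => zero_le_one.trans (hW b).1) fun b _ => ?_
        refine (hW b).2.trans (Real.exp_le_exp.2 ?_)
        exact mul_le_mul_of_nonneg_left (hU2K b) (sq_nonneg δ)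
    _ = _ := by rw [Finset.prod_const, Finset.card_range, ← Real.exp_nat_mul]

end

/-! ### Alternating blocks -/

/-- The numbers below `N` that lie in the `b`-th interval of length `s` and whose offset there is
in `[u, t)`. -/
def alternatingBlock (N s u t b : ℕ) : Finset ℕ :=
  (Finset.range N).filter fun k => k / s = b ∧ u ≤ k % s ∧ k % s < t

theorem card_alternatingBlock_le (N s u t b : ℕ) : (alternatingBlock N s u t b).card ≤ t - u := by
  have : (alternatingBlock N s u t b).card ≤ (Finset.Ico u t).card := by
    refine Finset.card_le_card_of_injOn (fun k => k % s) ?_ ?_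
    · intro k hk
      have := (Finset.mem_filter.1 hk).2
      exact Finset.mem_Ico.2 this.2
    · intro k hk k' hk' h
      have h1 := (Finset.mem_filter.1 hk).2.1
      have h2 := (Finset.mem_filter.1 hk').2.1
      rw [← Nat.div_add_mod k s, ← Nat.div_add_mod k' s, h1, h2, show k % s = k' % s from h]
  rwa [Nat.card_Ico] at this

/-- An element of block `i` is at most `s * i + t - 1` and one of a later block is at least `s * (i
+ 1) + u`, so they differ by at least `s - (t - u) + 1 > Q`. -/
theorem alternatingBlock_separated {N s u t Q : ℕ} (h : t - u + Q ≤ s) (hut : u < t) {i j : ℕ}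
    (hij : i < j) {k k' : ℕ} (hk : k ∈ alternatingBlock N s u t i)
    (hk' : k' ∈ alternatingBlock N s u t j) : k + Q < k' := by
  obtain ⟨h1, h2, h3⟩ := (Finset.mem_filter.1 hk).2
  obtain ⟨h1', h2', h3'⟩ := (Finset.mem_filter.1 hk').2
  have e := Nat.div_add_mod k s
  have e' := Nat.div_add_mod k' s
  rw [h1] at e
  rw [h1'] at e'
  have : s * (i + 1) ≤ s * j := Nat.mul_le_mul_left _ hij
  rw [mul_add, mul_one] at this
  generalize k % s = r at *
  generalize k' % s = r' at *
  omega

/-- The last interval may be incomplete; the restriction to numbers below `N` inside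
`alternatingBlock` takes care of this, so `N` need not be a multiple of `p + q`. -/
theorem sum_range_eq_alternatingBlock {N p q : ℕ} (hs : 0 < p + q) (g : ℕ → ℝ) :
    ∑ k ∈ Finset.range N, g k =
      ∑ b ∈ Finset.range ((N - 1) / (p + q) + 1), ∑ k ∈ alternatingBlock N (p + q) 0 p b, g k +
      ∑ b ∈ Finset.range ((N - 1) / (p + q) + 1),
        ∑ k ∈ alternatingBlock N (p + q) p (p + q) b, g k := by
  rw [← Finset.sum_add_distrib, ← Finset.sum_fiberwise_of_maps_to (s := Finset.range N)
    (t := Finset.range ((N - 1) / (p + q) + 1)) (g := fun k => k / (p + q))]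
  · refine Finset.sum_congr rfl fun b _ => ?_
    rw [← Finset.sum_union]
    · refine Finset.sum_congr ?_ fun _ _ => rfl
      ext k
      have := Nat.mod_lt k hs
      simp only [alternatingBlock, Finset.mem_union, Finset.mem_filter, Finset.mem_range]
      generalize k % (p + q) = r at *
      constructor
      · rintro ⟨h1, h2⟩
        rcases lt_or_ge r p with h | h
        · exact Or.inl ⟨h1, h2, Nat.zero_le _, h⟩
        · exact Or.inr ⟨h1, h2, h, this⟩
      · rintro (⟨h1, h2, -⟩ | ⟨h1, h2, -⟩) <;> exact ⟨h1, h2⟩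
    · refine Finset.disjoint_left.2 fun k hk hk' => ?_
      have h1 := (Finset.mem_filter.1 hk).2.2.2
      have h2 := (Finset.mem_filter.1 hk').2.2.1
      omega
  · intro k hk
    rw [Finset.mem_range] at hk ⊢
    exact Nat.lt_succ_of_le (Nat.div_le_div_right (by omega))

/-! ### Exponential moment of the strip sum -/

section
variable {Ω : Type*} [MeasurableSpace Ω] {μ : Measure Ω}  {A : ℕ} {Z : Node A → Ω → ℝ} {C σ : ℝ}

theorem measurable_stripSum (hZ : ∀ v, Measurable (Z v)) (L P : ℕ) :
    Measurable (stripSum Z L P) :=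
  Finset.measurable_fun_sum _ fun v _ => hZ v

theorem ae_abs_stripSum_le (hZC : ∀ v, ∀ᵐ ω ∂μ, |Z v ω| ≤ C) (L P : ℕ) :
    ∀ᵐ ω ∂μ, |stripSum Z L P ω| ≤ (strip_finite A L P).toFinset.card * C := by
  have : ∀ᵐ ω ∂μ, ∀ v ∈ (strip_finite A L P).toFinset, |Z v ω| ≤ C :=
    (Finset.eventually_all _).2 fun v _ => hZC v
  filter_upwards [this] with ω h
  refine (Finset.abs_sum_le_sum_abs _ _).trans ((Finset.sum_le_sum h).trans ?_)
  rw [Finset.sum_const, nsmul_eq_mul]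

variable [IsProbabilityMeasure μ]

theorem integrable_exp_mul_of_ae_bound {U : Ω → ℝ} {K : ℝ} (hU : Measurable U)
    (hK : ∀ᵐ ω ∂μ, |U ω| ≤ K) (γ : ℝ) : Integrable (fun ω => Real.exp (γ * U ω)) μ := by
  refine Integrable.of_bound (by fun_prop) (Real.exp (|γ| * K)) ?_
  filter_upwards [hK] with ω h
  rw [Real.norm_of_nonneg (Real.exp_pos _).le]
  refine Real.exp_le_exp.2 ((le_abs_self _).trans ?_)
  rw [abs_mul]
  exact mul_le_mul_of_nonneg_left h (abs_nonneg γ)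

theorem integral_exp_stripSum_le (hA : 2 ≤ A) (hC : 0 < C) (hZ : ∀ v, Measurable (Z v))
    (hZ_mean : ∀ v, ∫ ω, Z v ω ∂μ = 0) (hZC : ∀ v, ∀ᵐ ω ∂μ, |Z v ω| ≤ C)
    (hZ_var : ∀ v, variance (Z v) μ ≤ σ ^ 2) {L P P₂ Q₂ : ℕ} (hP : 1 ≤ P) (hQ₂ : 1 ≤ Q₂)
    (hQP : Q₂ ≤ P₂) {γ : ℝ}
    (hγ : |2 * γ| * (P₂ * ((∑ a ∈ Finset.range P, (A : ℝ) ^ a) * C)) ≤ 1) :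
    ∫ ω, Real.exp (γ * stripSum Z L P ω) ∂μ ≤
      Real.exp (((A ^ L - 1) / (P₂ + Q₂) + 1 : ℕ) * ((2 * γ) ^ 2 * ((P₂ : ℝ) ^ 2 *
        ((∑ a ∈ Finset.range P, (A : ℝ) ^ a) * σ ^ 2 +
        4 * C ^ 2 * ∑ k ∈ Finset.Icc 1 (2 * (P - 1)),
          alphaMixing (tree A) μ Z k * (numPairs A P k : ℝ))))) *
      (1 + alphaMixing (tree A) μ Z (2 * ⌈Real.log Q₂ / Real.log A⌉₊) *
        ((A ^ L - 1) / (P₂ + Q₂) + 1 : ℕ) * Real.exp 1 ^ ((A ^ L - 1) / (P₂ + Q₂) + 1)) := by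
  have h1 := integral_exp_blocks_le hA hC hZ hZ_mean hZC hZ_var (L := L) hP hQ₂ hγ
    (B := alternatingBlock (A ^ L) (P₂ + Q₂) 0 P₂)
    (fun b => (card_alternatingBlock_le _ _ _ _ b).trans (by omega))
    (fun i j hij k hk k' hk' =>
      alternatingBlock_separated (by omega) (by omega) hij hk hk')
    ((A ^ L - 1) / (P₂ + Q₂) + 1)
  -- For the short blocks `Q₂ ≤ P₂` enters twice: they contain `Q₂ ≤ P₂` subtrees, and the gaps
  -- between them have length `P₂ ≥ Q₂`.
  have h2 := integral_exp_blocks_le hA hC hZ hZ_mean hZC hZ_var (L := L) hP hQ₂ hγ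
    (B := alternatingBlock (A ^ L) (P₂ + Q₂) P₂ (P₂ + Q₂))
    (fun b => (card_alternatingBlock_le _ _ _ _ b).trans (by omega))
    (fun i j hij k hk k' hk' =>
      alternatingBlock_separated (by omega) (by omega) hij hk hk')
    ((A ^ L - 1) / (P₂ + Q₂) + 1)
  set m := (A ^ L - 1) / (P₂ + Q₂) + 1 with hm
  let S : (ℕ → Finset ℕ) → Ω → ℝ := fun B ω =>
    ∑ b ∈ Finset.range m, ∑ k ∈ B b, subtreeSum Z L P k ω
  have hSmeas : ∀ B, Measurable (S B) := fun B =>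
    Finset.measurable_fun_sum _ fun b _ => Finset.measurable_fun_sum _ fun k _ =>
      Finset.measurable_fun_sum _ fun v _ => hZ v
  have hSbd : ∀ B, ∀ᵐ ω ∂μ, |S B ω| ≤ ∑ b ∈ Finset.range m, ∑ k ∈ B b,
      ∑ v ∈ (subtree_finite A L (k + 1) P).toFinset, C := by
    intro B
    have : ∀ᵐ ω ∂μ, ∀ b ∈ Finset.range m, ∀ k ∈ B b,
        ∀ v ∈ (subtree_finite A L (k + 1) P).toFinset, |Z v ω| ≤ C :=
      (Finset.eventually_all _).2 fun b _ => (Finset.eventually_all _).2 fun k _ =>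
        (Finset.eventually_all _).2 fun v _ => hZC v
    filter_upwards [this] with ω h
    exact (Finset.abs_sum_le_sum_abs _ _).trans (Finset.sum_le_sum fun b hb =>
      (Finset.abs_sum_le_sum_abs _ _).trans (Finset.sum_le_sum fun k hk =>
        (Finset.abs_sum_le_sum_abs _ _).trans (Finset.sum_le_sum fun v hv => h b hb k hk v hv)))
  have hi1 := integrable_exp_mul_of_ae_bound
    (hSmeas (alternatingBlock (A ^ L) (P₂ + Q₂) 0 P₂)) (hSbd _) (2 * γ)
  have hi2 := integrable_exp_mul_of_ae_bound
    (hSmeas (alternatingBlock (A ^ L) (P₂ + Q₂) P₂ (P₂ + Q₂))) (hSbd _) (2 * γ)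
  -- Cross terms between the two families are removed by the inequality of arithmetic and geometric
  -- means, at the price of doubling `γ`.
  have hpt : ∀ ω, Real.exp (γ * stripSum Z L P ω) ≤
      (1 / 2) * (Real.exp (2 * γ * S (alternatingBlock (A ^ L) (P₂ + Q₂) 0 P₂) ω) +
        Real.exp (2 * γ * S (alternatingBlock (A ^ L) (P₂ + Q₂) P₂ (P₂ + Q₂)) ω)) := by
    intro ω
    have e : stripSum Z L P ω = S (alternatingBlock (A ^ L) (P₂ + Q₂) 0 P₂) ω +
        S (alternatingBlock (A ^ L) (P₂ + Q₂) P₂ (P₂ + Q₂)) ω := by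
      rw [stripSum_eq (by omega), sum_range_eq_alternatingBlock (p := P₂) (q := Q₂) (by omega)]
    rw [e]
    generalize S (alternatingBlock (A ^ L) (P₂ + Q₂) 0 P₂) ω = x
    generalize S (alternatingBlock (A ^ L) (P₂ + Q₂) P₂ (P₂ + Q₂)) ω = y
    rw [show γ * (x + y) = γ * x + γ * y by ring, show 2 * γ * x = γ * x + γ * x by ring,
      show 2 * γ * y = γ * y + γ * y by ring, Real.exp_add, Real.exp_add, Real.exp_add]
    nlinarith [sq_nonneg (Real.exp (γ * x) - Real.exp (γ * y))]
  have := integral_mono (integrable_exp_mul_of_ae_bound (measurable_stripSum hZ L P)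
    (ae_abs_stripSum_le hZC L P) γ) ((hi1.add hi2).const_mul (1 / 2)) hpt
  refine this.trans ?_
  simp only [Pi.add_apply]
  rw [integral_const_mul, integral_add hi1 hi2]
  linarith

end

end ExpTree

/-! ### The tail bound -/

theorem theorem1 {Ω : Type*} [MeasurableSpace Ω] (μ : Measure Ω) [IsProbabilityMeasure μ]
    (A : ℕ) (hA : 1 ≤ A) (Z : ExpTree.Node A → Ω → ℝ) (C σ : ℝ) (hC : 0 < C) (hσ : 0 < σ)
    (hZ_meas : ∀ v, Measurable (Z v))
    (hZ_mean : ∀ v, ∫ ω, Z v ω ∂μ = 0)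
    (hZ_bdd : ∀ v, eLpNorm (Z v) ⊤ μ ≤ ENNReal.ofReal C)
    (hZ_var : ∀ v, variance (Z v) μ ≤ σ ^ 2)
    (L P : ℕ) (hP : 1 ≤ P) (P₂ Q₂ : ℕ) (hP₂ : 1 ≤ P₂) (hQ₂ : 1 ≤ Q₂) (hQP : Q₂ ≤ P₂)
    (hPQ : P₂ + Q₂ < A ^ L)
    (β : ℝ) (hβ : β ≤ ((A : ℝ) - 1) / (4 * Real.exp 1 * C * P₂ * ((A : ℝ) ^ P - 1)))
    (f : ℕ) (hf : f = 2 * ⌈Real.log Q₂ / Real.log A⌉₊)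
    (ε : ℝ) (hε : 0 < ε) :
    μ.real {ω | ε < |ExpTree.stripSum Z L P ω|} ≤
      2 * Real.exp (-β * ε) *
      Real.exp (10 * √(Real.exp 1) *
        ExpTree.alphaMixing (ExpTree.tree A) μ Z f ^
          (((P₂ : ℝ) + Q₂) / (2 * P₂ + 2 * Q₂ + (A : ℝ) ^ L)) *
        ((A : ℝ) ^ L / ((P₂ : ℝ) + Q₂))) *
      Real.exp (4 * β ^ 2 * Real.exp 1 * (P₂ : ℝ) ^ 2 *
        (((A : ℝ) ^ P - 1) / ((A : ℝ) - 1) * σ ^ 2 +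
          4 * C ^ 2 * ∑ k ∈ Finset.Icc 1 (2 * (P - 1)),
            ExpTree.alphaMixing (ExpTree.tree A) μ Z k * (ExpTree.numPairs A P k : ℝ)) *
        ((A : ℝ) ^ L / ((P₂ : ℝ) + Q₂) + 1)) := by
  -- For `A = 1` the condition `P₂ + Q₂ < A ^ L` would read `P₂ + Q₂ < 1`.
  have hA2 : 2 ≤ A := by
    by_contra h
    obtain rfl : A = 1 := by omega
    rw [one_pow] at hPQ
    omega
  have hA2' : (2 : ℝ) ≤ A := by exact_mod_cast hA2
  have hgeom : ((A : ℝ) ^ P - 1) / ((A : ℝ) - 1) = ∑ a ∈ Finset.range P, (A : ℝ) ^ a :=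
    (geom_sum_eq (by linarith) P).symm
  rw [hgeom]
  have hα := ExpTree.alphaMixing_nonneg (G := ExpTree.tree A) (μ := μ) (Z := Z) f
  set α := ExpTree.alphaMixing (ExpTree.tree A) μ Z f with hαdef
  set D := ∑ a ∈ Finset.range P, (A : ℝ) ^ a with hD
  set K := D * σ ^ 2 + 4 * C ^ 2 * ∑ k ∈ Finset.Icc 1 (2 * (P - 1)),
    ExpTree.alphaMixing (ExpTree.tree A) μ Z k * (ExpTree.numPairs A P k : ℝ) with hK
  have hK0 : 0 ≤ K := by
    refine add_nonneg (by positivity) (mul_nonneg (by positivity) (Finset.sum_nonneg fun k _ => ?_))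
    exact mul_nonneg (ExpTree.alphaMixing_nonneg k) (Nat.cast_nonneg _)
  have hs : (0 : ℝ) < (P₂ : ℝ) + Q₂ := by positivity
  set n := (A : ℝ) ^ L / ((P₂ : ℝ) + Q₂) with hn
  have hn1 : 1 ≤ n := by
    rw [hn, one_le_div hs]
    exact_mod_cast hPQ.le
  have hexpo : ((P₂ : ℝ) + Q₂) / (2 * P₂ + 2 * Q₂ + (A : ℝ) ^ L) = 1 / (n + 2) := by
    rw [hn]
    field_simp
    ring
  rw [hexpo]
  rcases le_or_gt β 0 with hβ0 | hβ0
  -- For `β ≤ 0` every exponential on the right is at least `1`, so the bound is trivial.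
  · refine measureReal_le_one.trans ?_
    have e1 : 1 ≤ Real.exp (-β * ε) := Real.one_le_exp (by nlinarith)
    refine one_le_mul_of_one_le_of_one_le (one_le_mul_of_one_le_of_one_le (by linarith) ?_) ?_
    · exact Real.one_le_exp (by positivity)
    · exact Real.one_le_exp (by positivity)
  have hZC : ∀ v, ∀ᵐ ω ∂μ, |Z v ω| ≤ C := by
    intro v
    have h := hZ_bdd v
    rw [eLpNorm_exponent_top] at h
    filter_upwards [ae_le_eLpNormEssSup (f := Z v) (μ := μ)] with ω hω
    have := hω.trans h
    rwa [← ofReal_norm, ENNReal.ofReal_le_ofReal_iff hC.le, Real.norm_eq_abs] at this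
  have hD0 : 0 < D := by
    rw [← hgeom]
    exact div_pos (by linarith [one_lt_pow₀ (by linarith : (1 : ℝ) < A) (by omega : P ≠ 0)])
      (by linarith)
  -- The hypothesis on `β` even gives `1 / (2 * e)` here; the bound `1` is what the quadratic
  -- estimate of the exponential needs.
  have hβ' : 2 * β * (P₂ * (D * C)) ≤ 1 := by
    have hpos : 0 < 4 * Real.exp 1 * C * P₂ * D := by positivity
    have h1 : β ≤ 1 / (4 * Real.exp 1 * C * P₂ * D) := by
      refine hβ.trans (le_of_eq ?_)
      rw [← hgeom]
      have : (A : ℝ) - 1 ≠ 0 := by linarith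
      field_simp
    rw [le_div_iff₀ hpos] at h1
    have h2 := Real.one_le_exp (x := 1) zero_le_one
    have h3 : 0 ≤ β * (C * P₂ * D) := by positivity
    nlinarith
  set m := (A ^ L - 1) / (P₂ + Q₂) + 1 with hm
  have hmn : (m : ℝ) ≤ n + 1 := by
    rw [hm, Nat.cast_add, Nat.cast_one]
    refine add_le_add (Nat.cast_div_le.trans ?_) le_rfl
    rw [hn, Nat.cast_add]
    refine div_le_div_of_nonneg_right ?_ hs.le
    exact_mod_cast Nat.sub_le _ _
  -- Stated for `|γ| = β` so that it serves both tails. The constants have slack: `4` would do for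
  -- `10 * √e`, and the factor `e` in the variance term is not needed.
  have hmgf : ∀ γ : ℝ, |γ| = β → ∫ ω, Real.exp (γ * ExpTree.stripSum Z L P ω) ∂μ ≤
      Real.exp (10 * √(Real.exp 1) * α ^ (1 / (n + 2)) * n) *
        Real.exp (4 * β ^ 2 * Real.exp 1 * (P₂ : ℝ) ^ 2 * K * (n + 1)) := by
    intro γ hγ
    have h := ExpTree.integral_exp_stripSum_le hA2 hC hZ_meas hZ_mean hZC hZ_var (L := L) hP hQ₂
      hQP (γ := γ) (by rw [abs_mul, hγ, abs_two]; exact hβ')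
    rw [← hf, ← hαdef, ← hm, mul_comm] at h
    have hsq : (2 * γ) ^ 2 = 4 * β ^ 2 := by rw [mul_pow, ← sq_abs γ, hγ]; norm_num
    refine h.trans (mul_le_mul ?_ (Real.exp_le_exp.2 ?_) (Real.exp_pos _).le (Real.exp_pos _).le)
    · refine ExpTree.one_add_mul_exp_le hα hn1 hmn ?_
      have : 1 ≤ √(Real.exp 1) := Real.one_le_sqrt.2 (Real.one_le_exp zero_le_one)
      linarith
    · rw [hsq]
      have he := Real.one_le_exp (x := 1) zero_le_one
      have hy : 0 ≤ 4 * β ^ 2 * (P₂ : ℝ) ^ 2 * K := by positivity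
      calc (m : ℝ) * (4 * β ^ 2 * ((P₂ : ℝ) ^ 2 * K)) = 4 * β ^ 2 * (P₂ : ℝ) ^ 2 * K * m := by ring
        _ ≤ 4 * β ^ 2 * (P₂ : ℝ) ^ 2 * K * (n + 1) := mul_le_mul_of_nonneg_left hmn hy
        _ ≤ Real.exp 1 * (4 * β ^ 2 * (P₂ : ℝ) ^ 2 * K * (n + 1)) :=
            le_mul_of_one_le_left (by positivity) he
        _ = _ := by ring
  have hmeas := ExpTree.measurable_stripSum hZ_meas L P
  have hbd := ExpTree.ae_abs_stripSum_le hZC L P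
  have hup := measure_ge_le_exp_mul_mgf (μ := μ) (X := ExpTree.stripSum Z L P) ε hβ0.le
    (ExpTree.integrable_exp_mul_of_ae_bound hmeas hbd β)
  have hdown := measure_ge_le_exp_mul_mgf (μ := μ) (X := -ExpTree.stripSum Z L P) ε hβ0.le
    (by
      simp_rw [Pi.neg_apply, mul_neg, ← neg_mul]
      exact ExpTree.integrable_exp_mul_of_ae_bound hmeas hbd (-β))
  have hsub : {ω | ε < |ExpTree.stripSum Z L P ω|} ⊆
      {ω | ε ≤ ExpTree.stripSum Z L P ω} ∪ {ω | ε ≤ (-ExpTree.stripSum Z L P) ω} := by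
    intro ω hω
    rcases lt_abs.1 (show ε < |ExpTree.stripSum Z L P ω| from hω) with h | h
    · exact Or.inl h.le
    · exact Or.inr h.le
  have hE := Real.exp_pos (-β * ε)
  have h1 := mul_le_mul_of_nonneg_left (hmgf β (abs_of_pos hβ0)) hE.le
  have h2 := mul_le_mul_of_nonneg_left (hmgf (-β) (by rw [abs_neg, abs_of_pos hβ0])) hE.le
  have hneg : mgf (-ExpTree.stripSum Z L P) μ β =
      ∫ ω, Real.exp (-β * ExpTree.stripSum Z L P ω) ∂μ := by
    simp only [mgf, Pi.neg_apply, mul_neg, neg_mul]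
  rw [hneg] at hdown
  rw [mgf] at hup
  refine (measureReal_mono hsub).trans ((measureReal_union_le _ _).trans ?_)
  linarith
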